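/- **Setting.** Consider the $(2,2,M)$ X-network: two transmitters, two receivers, $M$ antennas at each node, with channel matrix $H_{ij}\in\mathbb C^{M\times M}$ from transmitter $i$ to receiver $j$. Let $T'\ge M$ be an even integer. Transmitter $i$ has for receiver $j$ a codeword $X'_{ij}\in\mathbb C^{M\times T'}$ of a linear dispersion code $X'=\sum_{l=1}^{L}\bigl(A^{lR}\,\mathrm{Re}\,x^l+A^{lI}\,\mathrm{Im}\,x^l\bigr)$, where the symbols $x^l$ range over a finite constellation $\mathcal S_{ij}\subset\mathbb C$; the dispersion matrices are the same for all $(i,j)$. Let $X_{i1}$ (resp. $X_{i2}$) be the $M\times\frac{3T'}2$ matrix obtained by inserting a zero column after (resp. before) each consecutive pair of columns of $X'_{i1}$ (resp. $X'_{i2}$). Transmitter $i$ sends $\sqrt{c_iP}\,(V_{i1}X_{i1}+V_{i2}X_{i2})$, where $c_i>0$ is a constant and $$V_{ij}=\frac{H_{ij'}^{-1}}{\sqrt{\mathrm{tr}\bigl(H_{ij'}^{-1}H_{ij'}^{-H}\bigr)}},\qquad \{j,j'\}=\{1,2\}.$$ Receiver $1$ obtains $Y_1=\sqrt P\sum_i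 H_{i1}\sqrt{c_i}\,(V_{i1}X_{i1}+V_{i2}X_{i2})+N_1$ and knows all channels. The code has the column cancellation property: there are functions $f_k:\mathbb C\to\mathbb C$ ($1\le k\le \frac{MT'}{2}$) such that $f_k(w)\sim\mathcal{CN}(0,\sigma_k^2)$ when $w\sim\mathcal{CN}(0,1)$, and permutations $\pi_p$ of $\{1,\dots,M\}$ such that every codeword satisfies $X'(m,p)+f_{(p-1)M/2+m}\bigl(X'(\pi_p(m),p+1)\bigr)=0$ for all $m$ and all odd $p\le T'-1$. In each triple of time slots $(t,t+1,t+2)$, $t=1,4,7,\dots$, with $p=\frac{2t+1}{3}$, receiver $1$ keeps column $t$, adds $f_{(p-1)M/2+m}\bigl(Y_1(\pi_p(m),t+2)\bigr)$ to $Y_1(m,t+1)$ for each $m$, and discards column $t+2$. The result is taken to be $$Y'_1=\sqrt{c_1P}\,H_{11}V_{11}X'_{11}+\sqrt{c_2P}\,H_{21}V_{21}X'_{21}+N'_1,\qquad(\ast)$$ where $N'_1$ is $N_1$ processed in the same way; given the channels, its entries are independent $\mathcal{CN}(0,1)$ in the odd columns and $\mathcal{CN}(0,1+\sigma_k^2)$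 in the even columns. (When the $f_k$ are real-linear, $(\ast)$ holds almost surely for the processed received matrix, whatever the interfering codewords $X'_{12},X'_{22}$ are.) **Theorem.** Suppose that all entries of the channel matrices $H_{ij}$ and of the noise matrix $N_1$ are i.i.d. $\mathcal{CN}(0,1)$, and that for $i=1,2$ the difference of any two distinct codewords $X'_{i1}$ has full rank $M$. Let $(X'_{11},X'_{21})\ne(\tilde X'_{11},\tilde X'_{21})$ be two distinct pairs of codewords. Then there is a constant $C>0$ such that for all $P>0$ the average (over channels and noise) pairwise error probability of maximum likelihood decoding from $Y'_1$ with known channels, i.e. the probability that $(\tilde X'_{11},\tilde X'_{21})$ has at least the likelihood of $(X'_{11},X'_{21})$ when the latter is sent, satisfies $$P_e\bigl((X'_{11},X'_{21})\to(\tilde X'_{11},\tilde X'_{21})\bigr)\le C\,P^{-M}.$$ Consequently the diversity gain $\liminf_{P\to\infty}\bigl(-\log P_e/\log P\bigr)$ is at least $M$. This holds when $Y'_1$ is given by $(\ast)$, and also, if all $f_k$ are real-linear, when $Y'_1$ is computed from the received matrix $Y_1$, with the same $C$ for all interfering codewords $X'_{12},X'_{22}$. -/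

import Mathlib

open MeasureTheory ProbabilityTheory Filter
open scoped NNReal ENNReal Matrix

noncomputable section

namespace XNetwork

/-- The circularly symmetric complex Gaussian law `CN(0, v)`: real and imaginary parts are
independent real Gaussians with mean `0` and variance `v / 2`. -/
def complexGaussian (v : ℝ≥0) : Measure ℂ :=
  ((gaussianReal 0 (v / 2)).prod (gaussianReal 0 (v / 2))).map Complex.measurableEquivRealProd.symm

/-- The density of `CN(0, v)` at `z`, for `v > 0`. -/
def complexGaussianDensity (v : ℝ≥0) (z : ℂ) : ℝ :=
  1 / (Real.pi * v) * Real.exp (-‖z‖ ^ 2 / v)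

/-- An `M × T'` space-time matrix with `T' = 2 q`. The column `(r, s)` stands for column
`2 r + s` (counted from `0`): the columns are grouped in `q` consecutive pairs. -/
abbrev CodeMatrix (M q : ℕ) : Type := Matrix (Fin M) (Fin q × Fin 2) ℂ

/-- An `M × 3T'/2` matrix, `T' = 2 q`. The column `(r, s)` stands for time slot `3 r + s`
(counted from `0`): the time slots are grouped in `q` consecutive triples. -/
abbrev TimeMatrix (M q : ℕ) : Type := Matrix (Fin M) (Fin q × Fin 3) ℂ

/-- The linear dispersion code `∑ i, (A i * Re x_i + B i * Im x_i)` with dispersion matrices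
`A i`, `B i`. -/
def dispersionCode {M q L : ℕ} (A B : Fin L → CodeMatrix M q) (x : Fin L → ℂ) : CodeMatrix M q :=
  ∑ i, (((x i).re : ℂ) • A i + ((x i).im : ℂ) • B i)

/-- All codewords of the linear dispersion code whose symbols are taken from the finite
constellation `S`. -/
def codebook {M q L : ℕ} (A B : Fin L → CodeMatrix M q) (S : Finset ℂ) : Set (CodeMatrix M q) :=
  {X | ∃ x : Fin L → ℂ, (∀ i, x i ∈ S) ∧ X = dispersionCode A B x}

/-- Insert a zero column after every pair of columns (symbols meant for the first receiver). -/
def padLast {M q : ℕ} (X : CodeMatrix M q) : TimeMatrix M q :=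
  Matrix.of fun m t => ![X m (t.1, 0), X m (t.1, 1), 0] t.2

/-- Insert a zero column before every pair of columns (symbols meant for the second receiver). -/
def padFirst {M q : ℕ} (X : CodeMatrix M q) : TimeMatrix M q :=
  Matrix.of fun m t => ![0, X m (t.1, 0), X m (t.1, 1)] t.2

/-- The channel-inverting precoder `G⁻¹ / √tr(G⁻¹ G⁻ᴴ)`. -/
def normalizedInverse {M : ℕ} (G : Matrix (Fin M) (Fin M) ℂ) : Matrix (Fin M) (Fin M) ℂ :=
  (((Real.sqrt (G⁻¹ * (G⁻¹)ᴴ).trace.re)⁻¹ : ℝ) : ℂ) • G⁻¹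

/-- The precoder that transmitter `i` applies to the symbols for receiver `j`: the normalized
inverse of its channel to the other receiver. Here `H i j` is the channel from transmitter `i`
to receiver `j` (indices `0`, `1`). -/
def precoder {M : ℕ} (H : Fin 2 → Fin 2 → Matrix (Fin M) (Fin M) ℂ) (i j : Fin 2) :
    Matrix (Fin M) (Fin M) ℂ :=
  normalizedInverse (H i j.rev)

/-- What transmitter `i` sends (before scaling by `√P`): `X j` is its codeword for receiver `j`
and `c` its power normalization constant. -/
def transmitted {M q : ℕ} (c : Fin 2 → ℝ) (H : Fin 2 → Fin 2 → Matrix (Fin M) (Fin M) ℂ)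
    (i : Fin 2) (X : Fin 2 → CodeMatrix M q) : TimeMatrix M q :=
  ((Real.sqrt (c i) : ℝ) : ℂ) • (precoder H i 0 * padLast (X 0) + precoder H i 1 * padFirst (X 1))

/-- The matrix received by the first receiver, `Y₁ = √P ∑ i, H i 1 * Xᵢ + N₁`, where `X i j` is the
codeword of transmitter `i` for receiver `j`. -/
def received {M q : ℕ} (P : ℝ) (c : Fin 2 → ℝ) (H : Fin 2 → Fin 2 → Matrix (Fin M) (Fin M) ℂ)
    (X : Fin 2 → Fin 2 → CodeMatrix M q) (N : TimeMatrix M q) : TimeMatrix M q :=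
  ((Real.sqrt P : ℝ) : ℂ) • (∑ i, H i 0 * transmitted c H i (X i)) + N

/-- The column cancellation property of a codeword, with respect to functions `f r m` and
permutations `π r` of the rows: the first column of each pair is cancelled by the image of the
second one. -/
def ColumnCancellation {M q : ℕ} (f : Fin q → Fin M → ℂ → ℂ) (π : Fin q → Equiv.Perm (Fin M))
    (X : CodeMatrix M q) : Prop :=
  ∀ r m, X m (r, 0) + f r m (X (π r m) (r, 1)) = 0

/-- The processing at the first receiver: in each triple of time slots keep the first, add to the
second the image of the third, and discard the third. -/
def process {M q : ℕ} (f : Fin q → Fin M → ℂ → ℂ) (π : Fin q → Equiv.Perm (Fin M))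
    (Y : TimeMatrix M q) : CodeMatrix M q :=
  Matrix.of fun m t => ![Y m (t.1, 0), Y m (t.1, 1) + f t.1 m (Y (π t.1 m) (t.1, 2))] t.2

/-- The noise-free desired signal after interference cancellation,
`√(c₁P) H₁₁ V₁₁ X'₁₁ + √(c₂P) H₂₁ V₂₁ X'₂₁`; here `X i` is the codeword `X'ᵢ₁`. -/
def desiredSignal {M q : ℕ} (P : ℝ) (c : Fin 2 → ℝ)
    (H : Fin 2 → Fin 2 → Matrix (Fin M) (Fin M) ℂ) (X : Fin 2 → CodeMatrix M q) :
    CodeMatrix M q :=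
  ∑ i, ((Real.sqrt (c i * P) : ℝ) : ℂ) • (H i 0 * precoder H i 0 * X i)

/-- The variances of the entries of the processed noise: `1` in the first column of each pair and
`1 + σ²` in the second one. -/
def noiseVariance {M q : ℕ} (σ : Fin q → Fin M → ℝ≥0) (m : Fin M) (t : Fin q × Fin 2) : ℝ≥0 :=
  ![1, 1 + σ t.1 m ^ 2] t.2

/-- The likelihood of the pair of codewords `X` given the processed observation `Y` and the
channel `H`: independent Gaussian noise entries of the variances `noiseVariance σ`. -/
def likelihood {M q : ℕ} (P : ℝ) (c : Fin 2 → ℝ) (σ : Fin q → Fin M → ℝ≥0)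
    (H : Fin 2 → Fin 2 → Matrix (Fin M) (Fin M) ℂ) (Y : CodeMatrix M q)
    (X : Fin 2 → CodeMatrix M q) : ℝ :=
  ∏ m, ∏ t, complexGaussianDensity (noiseVariance σ m t) (Y m t - desiredSignal P c H X m t)

/-- All entries of the four channel matrices and of the noise matrix, as one family. -/
def entries {Ω : Type*} {M q : ℕ} (H : Fin 2 → Fin 2 → Ω → Matrix (Fin M) (Fin M) ℂ)
    (N : Ω → TimeMatrix M q) :
    ((Fin 2 × Fin 2) × (Fin M × Fin M)) ⊕ (Fin M × (Fin q × Fin 3)) → Ω → ℂ :=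
  Sum.elim (fun k ω => H k.1.1 k.1.2 ω k.2.1 k.2.2) (fun k ω => N ω k.1 k.2)

/-- The average (over channel and noise) probability that maximum likelihood decoding, from the
observation `Y`, finds the pair of codewords `X'` at least as likely as the pair `X`. It is the
pairwise error probability of `X → X'` when `Y` is observed while `X` is sent. -/
def pairwiseError {Ω : Type*} [MeasurableSpace Ω] (μ : Measure Ω) {M q : ℕ} (P : ℝ)
    (c : Fin 2 → ℝ) (σ : Fin q → Fin M → ℝ≥0)
    (H : Fin 2 → Fin 2 → Ω → Matrix (Fin M) (Fin M) ℂ) (Y : Ω → CodeMatrix M q)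
    (X X' : Fin 2 → CodeMatrix M q) : ℝ :=
  μ.real {ω | likelihood P c σ (fun i j => H i j ω) (Y ω) X ≤
    likelihood P c σ (fun i j => H i j ω) (Y ω) X'}

/-- Diversity gain of an error probability `Pe` as a function of the power `P`:
`liminf_{P → ∞} -log Pe(P) / log P`, with `log 0 = -∞`. -/
def diversityGain (Pe : ℝ → ℝ) : EReal :=
  liminf (fun P : ℝ => -ENNReal.log (ENNReal.ofReal (Pe P)) / (Real.log P : EReal)) atTop

end XNetwork

end

open XNetwork

/-! The proof is a Chernoff bound over the noise followed by an average over the direct channels.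

Fix the channels and let `D` be the difference of the two noise-free signals. An error means that
the log-likelihood ratio is nonnegative, so its probability is at most the mean of the square root
of the likelihood ratio. As `π` permutes rows, every raw noise entry is used exactly once, and the
mean factorizes into Gaussian moment generating functions: it is the exponential of `-∑ ‖D m t‖ ^ 2
/ (4 v)`, `v` being the noise variance of the entry (`lintegral_exp_halfLogRatio`).

To average over the channels, choose a transmitter `i` whose two codewords differ. Its precoder `U`
depends only on the channel to the other receiver and has Frobenius norm `1`. The codeword
difference has a right inverse, so some entry `(a, b)` of its product with `U` is at least a
constant `ε` in modulus (`exists_le_norm_normalizedInverse_mul`). Given everything but column `a` of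
the direct channel of `i`, the `M` entries of column `b` of `D` are affine functions of distinct
independent `CN(0, 1)` variables, with a common slope of squared modulus at least `c i * P * ε ^ 2`.
Each contributes a factor `O(1 / P)`, whatever the offset, hence `P ^ (-M)`. The position `(a, b)`
depends on the channels, so a sum over all positions is taken.

For real-linear `f`, the interference arrives as a real multiple of the codewords and cancels
exactly (`process_received`). -/

namespace XNetwork

variable {M q : ℕ}

/-! ### Product integrals and complex Gaussian integrals -/

instance (v : ℝ≥0) : IsProbabilityMeasure (complexGaussian v) :=
  Measure.isProbabilityMeasure_map (by fun_prop)

theorem lintegral_pi_prod {ι : Type*} [Fintype ι] {β : ι → Type*} [∀ i, MeasurableSpace (β i)]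
    (ν : ∀ i, Measure (β i)) [∀ i, IsProbabilityMeasure (ν i)] (g : ∀ i, β i → ℝ≥0∞)
    (hg : ∀ i, Measurable (g i)) :
    ∫⁻ x, ∏ i, g i (x i) ∂Measure.pi ν = ∏ i, ∫⁻ z, g i z ∂ν i := by
  refine (lintegral_prod_eq_prod_lintegral_of_indepFun Finset.univ
    (fun i (x : ∀ i, β i) => g i (x i)) (iIndepFun_pi fun i => (hg i).aemeasurable)
    fun i => (hg i).comp (measurable_pi_apply i)).trans ?_
  refine Finset.prod_congr rfl fun i _ => ?_
  exact (measurePreserving_eval ν i).lintegral_comp (hg i)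

theorem complexGaussian_one_le :
    complexGaussian 1 ≤ ENNReal.ofReal (1 / Real.pi) • (volume : Measure ℂ) := by
  have h1 : gaussianReal 0 (1 / 2) ≤ ENNReal.ofReal (√Real.pi)⁻¹ • (volume : Measure ℝ) := by
    rw [gaussianReal_of_var_ne_zero _ (by norm_num), ← withDensity_const]
    refine withDensity_mono (ae_of_all _ fun x => ?_)
    rw [gaussianPDF_def]
    refine ENNReal.ofReal_le_ofReal ?_
    rw [gaussianPDFReal]
    have : 2 * Real.pi * ((1 / 2 : ℝ≥0) : ℝ) = Real.pi := by push_cast; ring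
    rw [this]
    refine mul_le_of_le_one_right (by positivity) (Real.exp_le_one_iff.2 ?_)
    rw [neg_div]
    exact neg_nonpos.2 (by positivity)
  have h2 := Measure.map_mono (Measure.prod_mono h1 h1)
    Complex.measurableEquivRealProd.symm.measurable
  refine h2.trans (le_of_eq ?_)
  rw [Measure.prod_smul_left, Measure.prod_smul_right, smul_smul, Measure.map_smul,
    ← ENNReal.ofReal_mul (by positivity)]
  congr 1
  · congr 1
    rw [← mul_inv, Real.mul_self_sqrt Real.pi_pos.le, one_div]
  · exact Complex.volume_preserving_equiv_real_prod.symm.map_eq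

instance : NullSingletonClass (complexGaussian 1) :=
  ⟨fun z => le_antisymm ((complexGaussian_one_le {z}).trans (by simp)) zero_le⟩

/-- The Gaussian density is at most `1 / π`, and against Lebesgue measure a translation removes `β`.
The uniformity in `β` allows all other channel entries to be frozen. -/
theorem lintegral_exp_neg_norm_affine_sq_le {s : ℝ} (hs : 0 < s) {α : ℂ} (hα : α ≠ 0) (β : ℂ) :
    ∫⁻ z, ENNReal.ofReal (Real.exp (-(s * ‖α * z + β‖ ^ 2))) ∂complexGaussian 1 ≤
      ENNReal.ofReal (1 / (s * ‖α‖ ^ 2)) := by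
  have hb : 0 < s * ‖α‖ ^ 2 := by positivity
  have key : ∫⁻ z : ℂ, ENNReal.ofReal (Real.exp (-(s * ‖α * z + β‖ ^ 2))) =
      ENNReal.ofReal (Real.pi / (s * ‖α‖ ^ 2)) := by
    have h1 := GaussianFourier.integral_rexp_neg_mul_sq_norm (V := ℂ) hb
    rw [Complex.finrank_real_complex] at h1
    norm_num at h1
    rw [← h1, ofReal_integral_eq_lintegral_ofReal]
    · rw [← lintegral_add_right_eq_self _ (-(β / α))]
      refine lintegral_congr fun z => ?_
      have : α * (z - β / α) + β = α * z := by field_simp; ring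
      rw [← sub_eq_add_neg, this, norm_mul]
      ring_nf
    -- A nonintegrable function would have Bochner integral `0`, but the value is positive.
    · by_contra hn
      rw [integral_undef hn] at h1
      exact absurd h1 (by positivity)
    · exact ae_of_all _ fun z => (Real.exp_pos _).le
  refine (lintegral_mono' complexGaussian_one_le le_rfl).trans (le_of_eq ?_)
  rw [lintegral_smul_measure, key, smul_eq_mul, ← ENNReal.ofReal_mul (by positivity)]
  congr 1
  field_simp

theorem lintegral_exp_mul_gaussianReal (v : ℝ≥0) (t : ℝ) :
    ∫⁻ x, ENNReal.ofReal (Real.exp (t * x)) ∂gaussianReal 0 v =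
      ENNReal.ofReal (Real.exp (v * t ^ 2 / 2)) := by
  rw [← ofReal_integral_eq_lintegral_ofReal (integrable_exp_mul_gaussianReal t)
    (ae_of_all _ fun _ => (Real.exp_pos _).le)]
  have := mgf_gaussianReal (p := gaussianReal 0 v) (X := id) Measure.map_id t
  simp only [mgf, id] at this
  rw [this, zero_mul, zero_add]

theorem lintegral_exp_re_conj_mul_complexGaussian (v : ℝ≥0) (w : ℂ) :
    ∫⁻ z, ENNReal.ofReal (Real.exp ((star w * z).re)) ∂complexGaussian v =
      ENNReal.ofReal (Real.exp (v * ‖w‖ ^ 2 / 4)) := by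
  rw [complexGaussian, lintegral_map (by fun_prop) (by fun_prop)]
  have : ∀ x : ℝ × ℝ, ENNReal.ofReal
      (Real.exp ((star w * Complex.measurableEquivRealProd.symm x).re)) =
      ENNReal.ofReal (Real.exp (w.re * x.1)) * ENNReal.ofReal (Real.exp (w.im * x.2)) := by
    intro x
    rw [← ENNReal.ofReal_mul (by positivity), ← Real.exp_add]
    simp [Complex.measurableEquivRealProd_symm_apply]
  simp_rw [this]
  rw [lintegral_prod_mul (f := fun a : ℝ => ENNReal.ofReal (Real.exp (w.re * a)))
      (g := fun a : ℝ => ENNReal.ofReal (Real.exp (w.im * a))) (by fun_prop) (by fun_prop),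
    lintegral_exp_mul_gaussianReal,
    lintegral_exp_mul_gaussianReal, ← ENNReal.ofReal_mul (by positivity), ← Real.exp_add,
    Complex.sq_norm, Complex.normSq_apply]
  congr 2
  push_cast
  ring

/-! ### Zero sets of polynomials are null -/

/-- Fubini and induction: for almost all values of the other variables the leading coefficient in
the first variable is nonzero, which leaves finitely many roots, and points are null. Applied to the
determinant, this excludes singular channels. -/
theorem ae_eval_ne_zero_of_fin (ν : Measure ℂ) [NullSingletonClass ν] [SigmaFinite ν] (n : ℕ) :
    ∀ p : MvPolynomial (Fin n) ℂ, p ≠ 0 →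
      ∀ᵐ x ∂Measure.pi (fun _ : Fin n => ν), MvPolynomial.eval x p ≠ 0 := by
  induction n with
  | zero =>
    intro p hp
    refine ae_of_all _ fun x => ?_
    rw [MvPolynomial.eq_C_of_isEmpty p, MvPolynomial.eval_C]
    intro h
    apply hp
    rw [MvPolynomial.eq_C_of_isEmpty p, h, map_zero]
  | succ n ih =>
    intro p hp
    have hq : MvPolynomial.finSuccEquiv ℂ n p ≠ 0 := by simpa using hp
    have hm := measurePreserving_piFinSuccAbove (fun _ : Fin (n + 1) => ν) 0
    have hmeas : MeasurableSet {z : ℂ × (Fin n → ℂ) | MvPolynomial.eval (Fin.cons z.1 z.2) p ≠ 0} := by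
      have : Continuous fun z : ℂ × (Fin n → ℂ) =>
          MvPolynomial.eval (Fin.cons z.1 z.2 : Fin (n + 1) → ℂ) p :=
        (MvPolynomial.continuous_eval p).comp
          (by refine continuous_pi fun i => ?_; refine Fin.cases ?_ (fun j => ?_) i <;> simp <;> fun_prop)
      exact this.measurable (measurableSet_singleton 0).compl
    have h : ∀ᵐ z ∂ν.prod (Measure.pi fun _ : Fin n => ν),
        MvPolynomial.eval (Fin.cons z.1 z.2) p ≠ 0 := by
      rw [Measure.ae_prod_iff_ae_ae hmeas, Measure.ae_ae_comm hmeas]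
      filter_upwards [ih _ (Polynomial.leadingCoeff_ne_zero.2 hq)] with s hs
      have hne : (MvPolynomial.finSuccEquiv ℂ n p).map (MvPolynomial.eval s) ≠ 0 := by
        intro h0
        apply hs
        have := congrArg (fun r => r.coeff (MvPolynomial.finSuccEquiv ℂ n p).natDegree) h0
        simpa using this
      have hfin : ({y : ℂ | ¬ MvPolynomial.eval (Fin.cons y s : Fin (n + 1) → ℂ) p ≠ 0}).Finite := by
        refine (Polynomial.finite_setOfPred_isRoot hne).subset fun y hy => ?_
        simp only [ne_eq, not_not, Set.mem_ofPred_eq] at hy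
        rw [MvPolynomial.eval_eq_eval_mv_eval'] at hy
        exact hy
      exact hfin.measure_zero ν
    have h' := hm.quasiMeasurePreserving.ae h
    filter_upwards [h'] with x hx
    convert hx using 3
    exact (Fin.cons_self_tail x).symm

theorem ae_eval_ne_zero {ι : Type*} [Fintype ι] (ν : Measure ℂ) [NullSingletonClass ν] [SigmaFinite ν]
    (p : MvPolynomial ι ℂ) (hp : p ≠ 0) :
    ∀ᵐ x ∂Measure.pi (fun _ : ι => ν), MvPolynomial.eval x p ≠ 0 := by
  let e := Fintype.equivFin ι
  have hm := measurePreserving_piCongrLeft (fun _ : Fin (Fintype.card ι) => ν) e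
  have hr : MvPolynomial.rename e p ≠ 0 :=
    fun h => hp (MvPolynomial.rename_injective e e.injective (by simpa using h))
  have h := hm.quasiMeasurePreserving.ae (ae_eval_ne_zero_of_fin ν _ _ hr)
  filter_upwards [h] with x hx
  rw [MvPolynomial.eval_rename] at hx
  convert hx using 3
  ext i
  exact (Equiv.piCongrLeft_apply_apply (fun _ => ℂ) e x i).symm

/-! ### The likelihood ratio and its exponential moment -/

theorem sum_pairs (F : Fin M → Fin q × Fin 2 → ℝ) :
    ∑ m, ∑ t, F m t = ∑ m, ∑ r, (F m (r, 0) + F m (r, 1)) := by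
  simp_rw [Fintype.sum_prod_type, Fin.sum_univ_two]

/-- The raw noise in row `k.1` of a third slot ends up in row `(π r).symm k.1` after processing; the
sum over rows absorbs the permutation. -/
theorem sum_triples (π : Fin q → Equiv.Perm (Fin M)) (a b c : Fin M → Fin q → ℝ) :
    ∑ k : Fin M × (Fin q × Fin 3), ![a k.1 k.2.1, b k.1 k.2.1, c ((π k.2.1).symm k.1) k.2.1] k.2.2 =
      ∑ m, ∑ r, (a m r + b m r + c m r) := by
  simp_rw [Fintype.sum_prod_type, Fin.sum_univ_three, Finset.sum_add_distrib]
  simp only [Matrix.cons_val_zero, Matrix.cons_val_one, Matrix.cons_val]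
  congr 1
  rw [Finset.sum_comm]
  conv_rhs => rw [Finset.sum_comm]
  exact Finset.sum_congr rfl fun r _ => Equiv.sum_comp (π r).symm fun m => c m r

theorem noiseVariance_pos (σ : Fin q → Fin M → ℝ≥0) (m : Fin M) (t : Fin q × Fin 2) :
    0 < (noiseVariance σ m t : ℝ) := by
  obtain ⟨r, s⟩ := t
  fin_cases s <;> simp [noiseVariance]
  positivity

theorem ofReal_exp_sum {ι : Type*} (s : Finset ι) (g : ι → ℝ) :
    ENNReal.ofReal (Real.exp (∑ i ∈ s, g i)) = ∏ i ∈ s, ENNReal.ofReal (Real.exp (g i)) := by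
  rw [Real.exp_sum, ENNReal.ofReal_prod_of_nonneg fun _ _ => (Real.exp_pos _).le]

/-- Half the logarithm of the ratio of the likelihoods of two signals with difference `D`, as a
function of the processed noise `n`. -/
noncomputable def halfLogRatio (σ : Fin q → Fin M → ℝ≥0) (D n : CodeMatrix M q) : ℝ :=
  ∑ m, ∑ t, (2 * (star (D m t) * n m t).re - ‖D m t‖ ^ 2) / (2 * noiseVariance σ m t)

/-- The exponent is a sum of functions of single raw noise entries, so the integral factorizes. The
law of `f r m` enters only through the third slots. -/
theorem lintegral_exp_halfLogRatio (f : Fin q → Fin M → ℂ → ℂ) (σ : Fin q → Fin M → ℝ≥0)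
    (π : Fin q → Equiv.Perm (Fin M)) (hfm : ∀ r m, Measurable (f r m))
    (hf : ∀ r m, (complexGaussian 1).map (f r m) = complexGaussian (σ r m ^ 2))
    (D : CodeMatrix M q) :
    ∫⁻ n : Fin M × (Fin q × Fin 3) → ℂ, ENNReal.ofReal (Real.exp
        (halfLogRatio σ D (process f π (Matrix.of fun m t => n (m, t)))))
        ∂Measure.pi (fun _ => complexGaussian 1) =
      ENNReal.ofReal (Real.exp (-∑ m, ∑ t, ‖D m t‖ ^ 2 / (4 * noiseVariance σ m t))) := by
  set u : Fin M → Fin q × Fin 2 → ℂ := fun m t => ((noiseVariance σ m t : ℝ) : ℂ)⁻¹ * D m t with hu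
  -- `g k` is the share of the raw noise entry `k` in the exponent; `c₀` is the deterministic part.
  let g : Fin M × (Fin q × Fin 3) → ℂ → ℝ := fun k z =>
    ![(star (u k.1 (k.2.1, 0)) * z).re, (star (u k.1 (k.2.1, 1)) * z).re,
      (star (u ((π k.2.1).symm k.1) (k.2.1, 1)) * f k.2.1 ((π k.2.1).symm k.1) z).re] k.2.2
  let c₀ : ℝ := ∑ m, ∑ t, ‖D m t‖ ^ 2 / (2 * noiseVariance σ m t)
  have hre : ∀ m t z, (star (D m t) * z).re / noiseVariance σ m t = (star (u m t) * z).re := by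
    intro m t z
    have : star (u m t) * z = ((noiseVariance σ m t : ℝ)⁻¹ : ℝ) * (star (D m t) * z) := by
      simp [hu, mul_assoc]
    rw [this, Complex.re_ofReal_mul, div_eq_inv_mul]
  have hexp : ∀ n : Fin M × (Fin q × Fin 3) → ℂ,
      halfLogRatio σ D (process f π (Matrix.of fun m t => n (m, t))) = ∑ k, g k (n k) + -c₀ := by
    intro n
    have h1 : ∑ k, g k (n k) = ∑ m, ∑ r, ((star (u m (r, 0)) * n (m, (r, 0))).re +
        (star (u m (r, 1)) * n (m, (r, 1))).re +
        (star (u m (r, 1)) * f r m (n (π r m, (r, 2)))).re) := by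
      rw [← sum_triples π]
      refine Finset.sum_congr rfl fun k _ => ?_
      obtain ⟨m, r, s⟩ := k
      fin_cases s <;> simp [g]
    rw [h1, ← sub_eq_add_neg]
    simp only [c₀, halfLogRatio]
    rw [sum_pairs, sum_pairs, ← Finset.sum_sub_distrib]
    refine Finset.sum_congr rfl fun m _ => ?_
    rw [← Finset.sum_sub_distrib]
    refine Finset.sum_congr rfl fun r _ => ?_
    simp only [← hre, process, Matrix.of_apply, Matrix.cons_val_zero, Matrix.cons_val_one, mul_add,
      Complex.add_re]
    have h0 := (noiseVariance_pos σ m (r, 0)).ne'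
    have h1 := (noiseVariance_pos σ m (r, 1)).ne'
    field_simp
    ring
  have hgm : ∀ k, Measurable (g k) := by
    rintro ⟨m, r, s⟩
    have := hfm r ((π r).symm m)
    fin_cases s <;> simp [g] <;> fun_prop
  have hgi : ∀ k, ∫⁻ z, ENNReal.ofReal (Real.exp (g k z)) ∂complexGaussian 1 =
      ENNReal.ofReal (Real.exp (![‖u k.1 (k.2.1, 0)‖ ^ 2 / 4, ‖u k.1 (k.2.1, 1)‖ ^ 2 / 4,
        (σ k.2.1 ((π k.2.1).symm k.1) : ℝ) ^ 2 * ‖u ((π k.2.1).symm k.1) (k.2.1, 1)‖ ^ 2 / 4]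
          k.2.2)) := by
    rintro ⟨m, r, s⟩
    fin_cases s
    · simpa [g] using lintegral_exp_re_conj_mul_complexGaussian 1 (u m (r, 0))
    · simpa [g] using lintegral_exp_re_conj_mul_complexGaussian 1 (u m (r, 1))
    · have h := lintegral_exp_re_conj_mul_complexGaussian (σ r ((π r).symm m) ^ 2)
        (u ((π r).symm m) (r, 1))
      rw [← hf, lintegral_map (by fun_prop) (hfm _ _)] at h
      simpa [g] using h
  simp_rw [hexp, Real.exp_add, ENNReal.ofReal_mul (Real.exp_pos _).le, ofReal_exp_sum]
  have hprod := lintegral_pi_prod (fun _ : Fin M × (Fin q × Fin 3) => complexGaussian 1)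
    (fun k z => ENNReal.ofReal (Real.exp (g k z)))
    fun k => (Real.measurable_exp.comp (hgm k)).ennreal_ofReal
  rw [lintegral_mul_const' _ _ ENNReal.ofReal_ne_top, hprod]
  simp_rw [hgi]
  rw [← ofReal_exp_sum, ← ENNReal.ofReal_mul (Real.exp_pos _).le, ← Real.exp_add,
    sum_triples π (fun m r => ‖u m (r, 0)‖ ^ 2 / 4) (fun m r => ‖u m (r, 1)‖ ^ 2 / 4)
      (fun m r => (σ r m : ℝ) ^ 2 * ‖u m (r, 1)‖ ^ 2 / 4)]
  congr 2
  simp only [c₀]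
  rw [sum_pairs, sum_pairs, ← sub_eq_add_neg, ← Finset.sum_sub_distrib, ← Finset.sum_neg_distrib]
  refine Finset.sum_congr rfl fun m _ => ?_
  rw [← Finset.sum_sub_distrib, ← Finset.sum_neg_distrib]
  refine Finset.sum_congr rfl fun r _ => ?_
  -- The second and third slots together give `(1 + σ²) ‖u‖² / 4`, which is `‖D‖² / (4 v)` since `u
  -- = D / v` and `v = 1 + σ²`. Subtracting `‖D‖² / (2 v)` leaves `-‖D‖² / (4 v)`.
  have hn : ∀ t, ‖u m t‖ ^ 2 = ‖D m t‖ ^ 2 / (noiseVariance σ m t : ℝ) ^ 2 := by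
    intro t
    simp only [hu, norm_mul, norm_inv, Complex.norm_real, Real.norm_of_nonneg (NNReal.coe_nonneg _)]
    rw [mul_pow, inv_pow, div_eq_inv_mul]
  have h1 : ((noiseVariance σ m (r, 1) : ℝ≥0) : ℝ) = 1 + (σ r m : ℝ) ^ 2 := by simp [noiseVariance]
  have h0 : ((noiseVariance σ m (r, 0) : ℝ≥0) : ℝ) = 1 := by simp [noiseVariance]
  rw [hn, hn, h1, h0]
  have : (1 + (σ r m : ℝ) ^ 2) ≠ 0 := by positivity
  field_simp
  ring

theorem halfLogRatio_nonneg_of_likelihood_le {P : ℝ} {c : Fin 2 → ℝ} {σ : Fin q → Fin M → ℝ≥0}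
    {H : Fin 2 → Fin 2 → Matrix (Fin M) (Fin M) ℂ} {n : CodeMatrix M q}
    {X X' : Fin 2 → CodeMatrix M q}
    (h : likelihood P c σ H (desiredSignal P c H X + n) X ≤
      likelihood P c σ H (desiredSignal P c H X + n) X') :
    0 ≤ halfLogRatio σ (desiredSignal P c H (X' - X)) n := by
  have hsub : ∀ m t, desiredSignal P c H (X' - X) m t =
      desiredSignal P c H X' m t - desiredSignal P c H X m t := by
    intro m t
    rw [← Matrix.sub_apply]
    simp [desiredSignal, Matrix.mul_sub, smul_sub, add_sub_add_comm]
  have key : ∀ y : CodeMatrix M q, ∏ m, ∏ t, complexGaussianDensity (noiseVariance σ m t) (y m t) =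
      (∏ m, ∏ t, 1 / (Real.pi * noiseVariance σ m t)) *
        Real.exp (∑ m, ∑ t, -‖y m t‖ ^ 2 / noiseVariance σ m t) := by
    intro y
    simp_rw [complexGaussianDensity, Finset.prod_mul_distrib, Real.exp_sum]
  have hpos : 0 < ∏ m, ∏ t, 1 / (Real.pi * (noiseVariance σ m t : ℝ)) :=
    Finset.prod_pos fun m _ => Finset.prod_pos fun t _ =>
      one_div_pos.2 (mul_pos Real.pi_pos (noiseVariance_pos σ m t))
  simp only [likelihood] at h
  have hl := key n
  have hr := key (n - desiredSignal P c H (X' - X))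
  have e1 : ∀ m t, (desiredSignal P c H X + n) m t - desiredSignal P c H X m t = n m t :=
    fun m t => by simp
  have e2 : ∀ m t, (desiredSignal P c H X + n) m t - desiredSignal P c H X' m t =
      (n - desiredSignal P c H (X' - X)) m t := fun m t => by
    simp only [Matrix.add_apply, Matrix.sub_apply, hsub]
    ring
  simp_rw [e1, e2] at h
  -- Both likelihoods carry the same normalizing constant, so only the exponents are compared.
  rw [hl, hr, mul_le_mul_iff_right₀ hpos, Real.exp_le_exp, ← sub_nonneg,
    ← Finset.sum_sub_distrib] at h
  simp_rw [← Finset.sum_sub_distrib] at h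
  have : halfLogRatio σ (desiredSignal P c H (X' - X)) n = (∑ m, ∑ t,
      (-‖(n - desiredSignal P c H (X' - X)) m t‖ ^ 2 / noiseVariance σ m t -
        -‖n m t‖ ^ 2 / noiseVariance σ m t)) / 2 := by
    rw [halfLogRatio, Finset.sum_div]
    refine Finset.sum_congr rfl fun m _ => ?_
    rw [Finset.sum_div]
    refine Finset.sum_congr rfl fun t _ => ?_
    have hv := (noiseVariance_pos σ m t).ne'
    simp only [Matrix.sub_apply, Complex.sq_norm, Complex.normSq_apply, Complex.sub_re,
      Complex.sub_im, Complex.mul_re, Complex.star_def, Complex.conj_re, Complex.conj_im]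
    field_simp
    ring
  rw [this]
  positivity

/-! ### The precoder: norm, lower bound and measurability -/

/-- The channel matrices with the entries `h`. -/
def channelOf (h : (Fin 2 × Fin 2) × (Fin M × Fin M) → ℂ) (i j : Fin 2) :
    Matrix (Fin M) (Fin M) ℂ :=
  Matrix.of fun a b => h ((i, j), (a, b))

theorem sum_norm_sq_normalizedInverse [NeZero M] {G : Matrix (Fin M) (Fin M) ℂ} (hG : G.det ≠ 0) :
    ∑ a, ∑ b, ‖normalizedInverse G a b‖ ^ 2 = 1 := by
  have htr : (G⁻¹ * (G⁻¹)ᴴ).trace.re = ∑ a, ∑ b, ‖G⁻¹ a b‖ ^ 2 := by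
    simp only [Matrix.trace, Matrix.diag, Matrix.mul_apply, Matrix.conjTranspose_apply,
      Complex.re_sum]
    refine Finset.sum_congr rfl fun a _ => Finset.sum_congr rfl fun b _ => ?_
    rw [Complex.star_def, Complex.mul_conj, Complex.ofReal_re, Complex.sq_norm]
  have hne : G⁻¹ ≠ 0 := by
    intro h
    have := Matrix.mul_nonsing_inv G (isUnit_iff_ne_zero.2 hG)
    rw [h, Matrix.mul_zero] at this
    exact zero_ne_one this
  have hpos : 0 < ∑ a, ∑ b, ‖G⁻¹ a b‖ ^ 2 := by
    obtain ⟨a, b, hab⟩ : ∃ a b, G⁻¹ a b ≠ 0 := by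
      by_contra! h
      exact hne (Matrix.ext h)
    refine Finset.sum_pos' (fun _ _ => by positivity) ⟨a, Finset.mem_univ _, ?_⟩
    exact Finset.sum_pos' (fun _ _ => by positivity) ⟨b, Finset.mem_univ _, by positivity⟩
  simp only [normalizedInverse, Matrix.smul_apply, smul_eq_mul, norm_mul, Complex.norm_real,
    mul_pow, htr, Real.norm_eq_abs, sq_abs, inv_pow, Real.sq_sqrt hpos.le]
  simp_rw [← Finset.mul_sum]
  exact inv_mul_cancel₀ hpos.ne'

/-- If all entries of `U * D` were smaller, `U = (U * D) * R` would have all entries below `1 / M`,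
contradicting Frobenius norm `1`. The bound does not depend on `G`. -/
theorem exists_le_norm_normalizedInverse_mul [NeZero M] {G : Matrix (Fin M) (Fin M) ℂ}
    (hG : G.det ≠ 0) {n : Type*} [Fintype n] {D : Matrix (Fin M) n ℂ} {R : Matrix n (Fin M) ℂ}
    (hDR : D * R = 1) :
    ∃ a b, 1 / (M * (1 + ∑ b, ∑ k, ‖R b k‖)) ≤ ‖(normalizedInverse G * D) a b‖ := by
  set U := normalizedInverse G
  set S := ∑ b, ∑ k, ‖R b k‖
  have hS : 0 ≤ S := by positivity
  have hM : (0 : ℝ) < M := by exact_mod_cast NeZero.pos M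
  by_contra! hlt
  have hU : ∀ a k, ‖U a k‖ < 1 / M := by
    intro a k
    have e : U a k = ∑ b, (U * D) a b * R b k := by
      rw [← Matrix.mul_apply, Matrix.mul_assoc, hDR, Matrix.mul_one]
    calc ‖U a k‖ ≤ ∑ b, ‖(U * D) a b‖ * ‖R b k‖ := by
          rw [e]
          exact (norm_sum_le _ _).trans (le_of_eq (Finset.sum_congr rfl fun b _ => norm_mul _ _))
      _ ≤ ∑ b, 1 / (M * (1 + S)) * ‖R b k‖ := by
          gcongr with b
          exact (hlt a b).le
      _ ≤ 1 / (M * (1 + S)) * S := by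
          rw [← Finset.mul_sum]
          exact mul_le_mul_of_nonneg_left (Finset.sum_le_sum fun b _ => Finset.single_le_sum
            (f := fun k => ‖R b k‖) (fun _ _ => norm_nonneg _) (Finset.mem_univ k)) (by positivity)
      _ < 1 / M := by
          rw [div_mul_eq_mul_div, one_mul, div_lt_div_iff₀ (by positivity) hM]
          nlinarith
  have hlt1 : ∑ a, ∑ k, ‖U a k‖ ^ 2 < ∑ _a : Fin M, ∑ _k : Fin M, (1 / (M : ℝ)) ^ 2 := by
    refine Finset.sum_lt_sum_of_nonempty Finset.univ_nonempty fun a _ => ?_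
    refine Finset.sum_lt_sum_of_nonempty Finset.univ_nonempty fun k _ => ?_
    exact pow_lt_pow_left₀ (hU a k) (norm_nonneg _) two_ne_zero
  rw [sum_norm_sq_normalizedInverse hG] at hlt1
  simp only [Finset.sum_const, Finset.card_univ, Fintype.card_fin, nsmul_eq_mul] at hlt1
  have : (M : ℝ) * (M * (1 / M) ^ 2) = 1 := by field_simp
  linarith

theorem measurable_det {Ω n : Type*} [MeasurableSpace Ω] [Fintype n] [DecidableEq n]
    {G : Ω → Matrix n n ℂ} (hG : ∀ a b, Measurable fun ω => G ω a b) :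
    Measurable fun ω => (G ω).det := by
  simp_rw [Matrix.det_apply']
  fun_prop

theorem measurable_normalizedInverse {Ω : Type*} [MeasurableSpace Ω]
    {G : Ω → Matrix (Fin M) (Fin M) ℂ} (hG : ∀ a b, Measurable fun ω => G ω a b) (a b : Fin M) :
    Measurable fun ω => normalizedInverse (G ω) a b := by
  have hadj : ∀ a b, Measurable fun ω => (G ω).adjugate a b := by
    intro a b
    simp_rw [Matrix.adjugate_apply]
    refine measurable_det fun k l => ?_
    simp_rw [Matrix.updateRow_apply]
    split_ifs
    · exact measurable_const
    · exact hG k l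
  have hdet := measurable_det hG
  have hinv : ∀ a b, Measurable fun ω => (G ω)⁻¹ a b := by
    intro a b
    simp_rw [Matrix.inv_def, Ring.inverse_eq_inv', Matrix.smul_apply, smul_eq_mul]
    have := hadj a b
    fun_prop
  have htr : Measurable fun ω => ((G ω)⁻¹ * ((G ω)⁻¹)ᴴ).trace := by
    simp only [Matrix.trace, Matrix.diag, Matrix.mul_apply, Matrix.conjTranspose_apply]
    exact Finset.measurable_sum _ fun k _ => Finset.measurable_sum _ fun l _ =>
      (hinv k l).mul (Complex.continuous_conj.measurable.comp (hinv k l))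
  simp only [normalizedInverse, Matrix.smul_apply, smul_eq_mul]
  exact (Complex.measurable_ofReal.comp
    (Complex.measurable_re.comp htr).sqrt.inv).mul (hinv a b)

theorem measurable_precoder_channelOf (i j : Fin 2) (a b : Fin M) :
    Measurable fun h => precoder (channelOf h) i j a b :=
  measurable_normalizedInverse (fun _ _ => measurable_pi_apply _) a b

theorem measurable_desiredSignal_channelOf (P : ℝ) (c : Fin 2 → ℝ) (D : Fin 2 → CodeMatrix M q)
    (m : Fin M) (t : Fin q × Fin 2) :
    Measurable fun h => desiredSignal P c (channelOf h) D m t := by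
  have := measurable_precoder_channelOf (M := M)
  have h1 : ∀ (i j : Fin 2) (a b : Fin M), Measurable fun h => channelOf h i j a b :=
    fun i j a b => measurable_pi_apply _
  simp only [desiredSignal, Matrix.sum_apply, Matrix.smul_apply, Matrix.mul_apply, smul_eq_mul]
  fun_prop

/-! ### Averaging over the direct channels -/

theorem desiredSignal_apply (P : ℝ) (c : Fin 2 → ℝ)
    (H : Fin 2 → Fin 2 → Matrix (Fin M) (Fin M) ℂ) (D : Fin 2 → CodeMatrix M q)
    (m : Fin M) (t : Fin q × Fin 2) :
    desiredSignal P c H D m t = ∑ p : Fin 2 × Fin M,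
      ((Real.sqrt (c p.1 * P) : ℝ) : ℂ) * (precoder H p.1 0 * D p.1) p.2 t * H p.1 0 m p.2 := by
  simp only [desiredSignal, Matrix.sum_apply, Matrix.smul_apply, smul_eq_mul, Matrix.mul_assoc]
  rw [Fintype.sum_prod_type]
  refine Finset.sum_congr rfl fun i _ => ?_
  rw [Matrix.mul_apply, Finset.mul_sum]
  exact Finset.sum_congr rfl fun a _ => by ring

/-- The index of the entry `(m, a)` of the channel from transmitter `i` to the first receiver, as
a function of the row `m`. -/
def directEntry (i : Fin 2) (a : Fin M) : Fin M ↪ (Fin 2 × Fin 2) × (Fin M × Fin M) :=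
  ⟨fun m => ((i, 0), (m, a)), fun m m' h => by simpa using h⟩

/-- The precoder for the first receiver inverts the channel to the second one, so it does not see
the entries in `s`. -/
theorem precoder_channelOf_updateFinset {s : Finset ((Fin 2 × Fin 2) × (Fin M × Fin M))}
    (hs : ∀ k ∈ s, k.1.2 = 0) (x : (Fin 2 × Fin 2) × (Fin M × Fin M) → ℂ) (y : s → ℂ) (j : Fin 2) :
    precoder (channelOf (Function.updateFinset x s y)) j 0 = precoder (channelOf x) j 0 := by
  unfold precoder
  congr 1
  ext k l
  have hn : ((j, Fin.rev (0 : Fin 2)), (k, l)) ∉ s := fun h => absurd (hs _ h) (by simp)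
  exact dif_neg hn

/-- Once the coordinates outside `s` are fixed, membership in `A` is decided: the inner integral
either vanishes or is bounded by `h`. -/
theorem lintegral_indicator_le_of_updateFinset {ι : Type*} [Fintype ι] [DecidableEq ι]
    (ν : Measure ℂ) [IsProbabilityMeasure ν] (s : Finset ι) {A : Set (ι → ℂ)}
    (hA : MeasurableSet A) {F : (ι → ℂ) → ℝ≥0∞} (hF : Measurable F) {K : ℝ≥0∞}
    (hinv : ∀ x (y : s → ℂ), Function.updateFinset x s y ∈ A ↔ x ∈ A)
    (h : ∀ x ∈ A, ∫⁻ y : s → ℂ, F (Function.updateFinset x s y) ∂Measure.pi (fun _ => ν) ≤ K) :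
    ∫⁻ x, A.indicator F x ∂Measure.pi (fun _ => ν) ≤ K := by
  have hK : K = ∫⁻ _, K ∂Measure.pi (fun _ : ι => ν) := by simp
  rw [hK]
  refine lintegral_le_of_lmarginal_le s (hF.indicator hA) measurable_const fun x => ?_
  simp only [lmarginal, lintegral_const, measure_univ, mul_one]
  by_cases hx : x ∈ A
  · refine (lintegral_congr fun y => ?_).trans_le (h x hx)
    exact Set.indicator_of_mem ((hinv x y).2 hx) F
  · refine (le_of_eq ?_).trans zero_le
    refine (lintegral_congr fun y => ?_).trans lintegral_zero
    exact Set.indicator_of_notMem (mt (hinv x y).1 hx) F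

theorem lintegral_updateFinset_exp_neg_desiredSignal_le (c : Fin 2 → ℝ) (hc : ∀ i, 0 < c i)
    (σ : Fin q → Fin M → ℝ≥0) (D : Fin 2 → CodeMatrix M q) {P : ℝ} (hP : 0 < P) {ε : ℝ}
    (hε : 0 < ε) (i : Fin 2) (a : Fin M) (b : Fin q × Fin 2)
    (x : (Fin 2 × Fin 2) × (Fin M × Fin M) → ℂ)
    (hx : ε ≤ ‖(precoder (channelOf x) i 0 * D i) a b‖) :
    ∫⁻ y : Finset.univ.map (directEntry i a) → ℂ, ENNReal.ofReal (Real.exp (-∑ m, ∑ t,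
        ‖desiredSignal P c (channelOf (Function.updateFinset x _ y)) D m t‖ ^ 2 /
          (4 * noiseVariance σ m t))) ∂Measure.pi (fun _ => complexGaussian 1) ≤
      ENNReal.ofReal (∏ m, 4 * noiseVariance σ m b / (c i * P * ε ^ 2)) := by
  set s := Finset.univ.map (directEntry i a) with hs
  have hprec := precoder_channelOf_updateFinset (s := s) (by
    intro k hk
    obtain ⟨m, -, rfl⟩ := Finset.mem_map.1 hk
    rfl)
  set W := (precoder (channelOf x) i 0 * D i) a b
  set α : ℂ := ((Real.sqrt (c i * P) : ℝ) : ℂ) * W with hα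
  have hcP : 0 < c i * P := mul_pos (hc i) hP
  have hα_le : c i * P * ε ^ 2 ≤ ‖α‖ ^ 2 := by
    rw [hα, norm_mul, mul_pow, Complex.norm_real, Real.norm_of_nonneg (Real.sqrt_nonneg _),
      Real.sq_sqrt hcP.le]
    gcongr
  have hα0 : α ≠ 0 := by
    intro h
    rw [h, norm_zero] at hα_le
    have : 0 < c i * P * ε ^ 2 := by positivity
    norm_num at hα_le
    linarith
  -- The offset collects all direct entries of row `m` other than `(m, a)` of transmitter `i`,
  -- including those of the other transmitter; none of them lies in `s`.
  let β : Fin M → ℂ := fun m => ∑ p ∈ Finset.univ.erase (i, a),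
    ((Real.sqrt (c p.1 * P) : ℝ) : ℂ) * (precoder (channelOf x) p.1 0 * D p.1) p.2 b *
      channelOf x p.1 0 m p.2
  have hdes : ∀ (y : s → ℂ) (m : Fin M),
      desiredSignal P c (channelOf (Function.updateFinset x s y)) D m b =
        α * Function.updateFinset x s y (directEntry i a m) + β m := by
    intro y m
    rw [desiredSignal_apply, ← Finset.add_sum_erase _ _ (Finset.mem_univ (i, a))]
    refine congrArg₂ (· + ·) ?_ (Finset.sum_congr rfl fun p hp => ?_)
    · dsimp only
      rw [hprec]
      rfl
    · rw [hprec]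
      refine congrArg₂ (· * ·) rfl ?_
      have hn : ((p.1, (0 : Fin 2)), (m, p.2)) ∉ s := by
        intro h
        obtain ⟨m', -, hm'⟩ := Finset.mem_map.1 h
        change ((i, (0 : Fin 2)), (m', a)) = ((p.1, 0), (m, p.2)) at hm'
        simp only [Prod.mk.injEq] at hm'
        exact (Finset.mem_erase.1 hp).1 (Prod.ext hm'.1.1.symm hm'.2.2.symm)
      simp only [channelOf, Matrix.of_apply, Function.updateFinset, dif_neg hn]
  have hsρ : ∀ m, 0 < 1 / (4 * (noiseVariance σ m b : ℝ)) := fun m =>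
    one_div_pos.2 (mul_pos (by norm_num) (noiseVariance_pos σ m b))
  have hsum : ∀ G : (Fin 2 × Fin 2) × (Fin M × Fin M) → ℝ,
      ∑ k ∈ s, G k = ∑ m, G (directEntry i a m) := fun G => Finset.sum_map _ _ _
  let ρ : Fin M → ℝ := fun m => 1 / (4 * (noiseVariance σ m b : ℝ))
  let g : s → ℂ → ℝ≥0∞ := fun k z =>
    ENNReal.ofReal (Real.exp (-(ρ k.1.2.1 * ‖α * z + β k.1.2.1‖ ^ 2)))
  have hg : ∀ k, Measurable (g k) := fun k => by simp only [g]; fun_prop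
  have hle : ∀ y : s → ℂ, ENNReal.ofReal (Real.exp (-∑ m, ∑ t,
      ‖desiredSignal P c (channelOf (Function.updateFinset x s y)) D m t‖ ^ 2 /
        (4 * noiseVariance σ m t))) ≤ ∏ k, g k (y k) := by
    intro y
    simp only [g]
    rw [← ofReal_exp_sum]
    refine ENNReal.ofReal_le_ofReal (Real.exp_le_exp.2 ?_)
    have e : ∑ k : s, -(ρ k.1.2.1 * ‖α * y k + β k.1.2.1‖ ^ 2) =
        ∑ m, -(‖desiredSignal P c (channelOf (Function.updateFinset x s y)) D m b‖ ^ 2 /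
          (4 * noiseVariance σ m b)) := by
      have h : ∀ k : s, y k = Function.updateFinset x s y k := fun k => by
        rw [Function.updateFinset, dif_pos k.2]
      simp_rw [h]
      rw [Finset.sum_coe_sort s fun k =>
        -(ρ k.2.1 * ‖α * Function.updateFinset x s y k + β k.2.1‖ ^ 2), hsum]
      refine Finset.sum_congr rfl fun m _ => ?_
      rw [hdes, div_eq_mul_one_div, mul_comm]
      rfl
    rw [e, Finset.sum_neg_distrib]
    -- Only column `b` of the signal is kept; the other columns merely decrease the exponential.
    refine neg_le_neg (Finset.sum_le_sum fun m _ => ?_)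
    exact Finset.single_le_sum (f := fun t =>
      ‖desiredSignal P c (channelOf (Function.updateFinset x s y)) D m t‖ ^ 2 /
        (4 * (noiseVariance σ m t : ℝ))) (fun t _ => by positivity) (Finset.mem_univ b)
  have hgi : ∀ k, ∫⁻ z, g k z ∂complexGaussian 1 ≤
      ENNReal.ofReal (4 * noiseVariance σ k.1.2.1 b / (c i * P * ε ^ 2)) := by
    intro k
    refine (lintegral_exp_neg_norm_affine_sq_le (hsρ _) hα0 _).trans
      (ENNReal.ofReal_le_ofReal ?_)
    have := noiseVariance_pos σ k.1.2.1 b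
    rw [one_div_mul_eq_div, one_div_div]
    gcongr
  have hprod : ∏ k : s, ENNReal.ofReal (4 * noiseVariance σ k.1.2.1 b / (c i * P * ε ^ 2)) =
      ENNReal.ofReal (∏ m, 4 * noiseVariance σ m b / (c i * P * ε ^ 2)) := by
    rw [Finset.prod_coe_sort s fun k =>
      ENNReal.ofReal (4 * noiseVariance σ k.2.1 b / (c i * P * ε ^ 2)), hs, Finset.prod_map,
      ENNReal.ofReal_prod_of_nonneg fun m _ => ?_]
    · rfl
    · have := hc i
      positivity
  rw [← hprod]
  refine (lintegral_mono hle).trans ?_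
  rw [lintegral_pi_prod (fun _ : s => complexGaussian 1) g hg]
  exact Finset.prod_le_prod' fun k _ => hgi k

theorem lintegral_indicator_exp_neg_desiredSignal_le (c : Fin 2 → ℝ) (hc : ∀ i, 0 < c i)
    (σ : Fin q → Fin M → ℝ≥0) (D : Fin 2 → CodeMatrix M q) {P : ℝ} (hP : 0 < P) {ε : ℝ}
    (hε : 0 < ε) (i : Fin 2) (a : Fin M) (b : Fin q × Fin 2) :
    ∫⁻ h, {h | ε ≤ ‖(precoder (channelOf h) i 0 * D i) a b‖}.indicator (fun h => ENNReal.ofReal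
        (Real.exp (-∑ m, ∑ t, ‖desiredSignal P c (channelOf h) D m t‖ ^ 2 /
          (4 * noiseVariance σ m t)))) h ∂Measure.pi (fun _ => complexGaussian 1) ≤
      ENNReal.ofReal (∏ m, 4 * noiseVariance σ m b / (c i * P * ε ^ 2)) := by
  refine lintegral_indicator_le_of_updateFinset _ (Finset.univ.map (directEntry i a)) ?_ ?_ ?_
    fun x hx => lintegral_updateFinset_exp_neg_desiredSignal_le c hc σ D hP hε i a b x hx
  · refine measurableSet_le measurable_const ?_
    have := measurable_precoder_channelOf (M := M)
    simp only [Matrix.mul_apply]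
    fun_prop
  · have := measurable_desiredSignal_channelOf P c D
    fun_prop
  · intro x y
    rw [Set.mem_ofPred_eq, Set.mem_ofPred_eq, precoder_channelOf_updateFinset]
    intro k hk
    obtain ⟨m, -, rfl⟩ := Finset.mem_map.1 hk
    rfl

theorem ae_det_channelOf_ne_zero (i j : Fin 2) :
    ∀ᵐ h ∂Measure.pi (fun _ : (Fin 2 × Fin 2) × (Fin M × Fin M) => complexGaussian 1),
      (channelOf h i j).det ≠ 0 := by
  have hinj : Function.Injective
      (fun p : Fin M × Fin M => (((i, j), p) : (Fin 2 × Fin 2) × (Fin M × Fin M))) :=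
    fun p p' h => by simpa using h
  have hne : MvPolynomial.rename (fun p : Fin M × Fin M => ((i, j), p))
      (Matrix.mvPolynomialX (Fin M) (Fin M) ℂ).det ≠ 0 := fun h =>
    Matrix.det_mvPolynomialX_ne_zero (Fin M) ℂ
      (MvPolynomial.rename_injective _ hinj (by rw [h, map_zero]))
  filter_upwards [ae_eval_ne_zero (complexGaussian 1) _ hne] with h hh
  rw [MvPolynomial.eval_rename, RingHom.map_det] at hh
  have := Matrix.mvPolynomialX_mapMatrix_eval (channelOf h i j)
  rwa [← this]

theorem exists_lintegral_exp_neg_desiredSignal_le [NeZero M] (c : Fin 2 → ℝ) (hc : ∀ i, 0 < c i)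
    (σ : Fin q → Fin M → ℝ≥0) (D : Fin 2 → CodeMatrix M q) (i : Fin 2)
    {R : Matrix (Fin q × Fin 2) (Fin M) ℂ} (hR : D i * R = 1) :
    ∃ C : ℝ, 0 < C ∧ ∀ P : ℝ, 0 < P →
      ∫⁻ h, ENNReal.ofReal (Real.exp (-∑ m, ∑ t, ‖desiredSignal P c (channelOf h) D m t‖ ^ 2 /
          (4 * noiseVariance σ m t))) ∂Measure.pi (fun _ => complexGaussian 1) ≤
        ENNReal.ofReal (C * P ^ (-(M : ℤ))) := by
  set ε : ℝ := 1 / (M * (1 + ∑ b, ∑ k, ‖R b k‖)) with hεdef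
  have hM : (0 : ℝ) < M := by exact_mod_cast NeZero.pos M
  have hε : 0 < ε := by positivity
  have hci := hc i
  have hC : 0 ≤ ∑ p : Fin M × (Fin q × Fin 2),
    ∏ m, 4 * (noiseVariance σ m p.2 : ℝ) / (c i * ε ^ 2) := by positivity
  -- The summand `1` only makes the constant visibly positive.
  refine ⟨(∑ p : Fin M × (Fin q × Fin 2),
    ∏ m, 4 * (noiseVariance σ m p.2 : ℝ) / (c i * ε ^ 2)) + 1, by positivity, fun P hP => ?_⟩
  let F : ((Fin 2 × Fin 2) × (Fin M × Fin M) → ℂ) → ℝ≥0∞ := fun h =>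
    ENNReal.ofReal (Real.exp (-∑ m, ∑ t, ‖desiredSignal P c (channelOf h) D m t‖ ^ 2 /
          (4 * noiseVariance σ m t)))
  let A : Fin M × (Fin q × Fin 2) → Set ((Fin 2 × Fin 2) × (Fin M × Fin M) → ℂ) := fun p =>
    {h | ε ≤ ‖(precoder (channelOf h) i 0 * D i) p.1 p.2‖}
  have hF : Measurable F := by
    have := measurable_desiredSignal_channelOf P c D
    fun_prop
  have hA : ∀ p, MeasurableSet (A p) := fun p => by
    refine measurableSet_le measurable_const ?_
    have := measurable_precoder_channelOf (M := M)
    simp only [Matrix.mul_apply]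
    fun_prop
  calc ∫⁻ h, F h ∂Measure.pi (fun _ => complexGaussian 1)
      ≤ ∫⁻ h, ∑ p, (A p).indicator F h ∂Measure.pi (fun _ => complexGaussian 1) := by
        -- Off the null set of singular channels, `h` lies in some `A p`, so `F h` is one of the
        -- summands.
        refine lintegral_mono_ae ?_
        filter_upwards [ae_det_channelOf_ne_zero i 1] with h hh
        obtain ⟨a, b, hab⟩ := exists_le_norm_normalizedInverse_mul hh hR
        have hmem : h ∈ A (a, b) := hab
        rw [← Set.indicator_of_mem hmem F]
        exact Finset.single_le_sum (f := fun p => (A p).indicator F h) (fun _ _ => zero_le)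
          (Finset.mem_univ (a, b))
    _ = ∑ p, ∫⁻ h, (A p).indicator F h ∂Measure.pi (fun _ => complexGaussian 1) :=
        lintegral_finsetSum _ fun p _ => hF.indicator (hA p)
    _ ≤ ∑ p : Fin M × (Fin q × Fin 2),
          ENNReal.ofReal (∏ m, 4 * noiseVariance σ m p.2 / (c i * P * ε ^ 2)) :=
        Finset.sum_le_sum fun p _ =>
          lintegral_indicator_exp_neg_desiredSignal_le c hc σ D hP hε i p.1 p.2
    _ = ENNReal.ofReal (∑ p : Fin M × (Fin q × Fin 2),
          ∏ m, 4 * noiseVariance σ m p.2 / (c i * P * ε ^ 2)) :=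
        (ENNReal.ofReal_sum_of_nonneg fun p _ => by positivity).symm
    _ ≤ _ := by
        refine ENNReal.ofReal_le_ofReal ?_
        rw [add_mul, Finset.sum_mul]
        refine le_add_of_le_of_nonneg (Finset.sum_le_sum fun p _ => le_of_eq ?_) (by positivity)
        have e : ∀ m, 4 * (noiseVariance σ m p.2 : ℝ) / (c i * P * ε ^ 2) =
            4 * noiseVariance σ m p.2 / (c i * ε ^ 2) * P⁻¹ := fun m => by field_simp
        simp_rw [e]
        rw [Finset.prod_mul_distrib, Finset.prod_const, Finset.card_univ, Fintype.card_fin,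
          zpow_neg, zpow_natCast, inv_pow]

/-! ### Interference cancellation -/

/-- For singular `G` the inverse is `0` by convention and `κ = 0` works. Hence the cancellation
below holds for every channel, not only almost surely. -/
theorem exists_mul_normalizedInverse_eq_smul_one (G : Matrix (Fin M) (Fin M) ℂ) :
    ∃ κ : ℝ, G * normalizedInverse G = (κ : ℂ) • (1 : Matrix (Fin M) (Fin M) ℂ) := by
  by_cases hG : IsUnit G.det
  · exact ⟨_, by rw [normalizedInverse, Matrix.mul_smul, Matrix.mul_nonsing_inv G hG]⟩
  · exact ⟨0, by simp [normalizedInverse, Matrix.nonsing_inv_apply_not_isUnit G hG]⟩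

theorem mul_padLast (B : Matrix (Fin M) (Fin M) ℂ) (X : CodeMatrix M q) :
    B * padLast X = padLast (B * X) := by
  ext m ⟨r, s⟩
  fin_cases s <;> simp [padLast, Matrix.mul_apply]

theorem process_received {f : Fin q → Fin M → ℂ → ℂ} {π : Fin q → Equiv.Perm (Fin M)}
    (hf : ∀ r m, IsLinearMap ℝ (f r m)) (P : ℝ) {c : Fin 2 → ℝ} (hc : ∀ i, 0 < c i)
    (H : Fin 2 → Fin 2 → Matrix (Fin M) (Fin M) ℂ) (X Z : Fin 2 → CodeMatrix M q)
    (hZ : ∀ i, ColumnCancellation f π (Z i)) (N : TimeMatrix M q) :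
    process f π (received P c H (fun i => ![X i, Z i]) N) =
      desiredSignal P c H X + process f π N := by
  choose κ hκ using fun i => exists_mul_normalizedInverse_eq_smul_one (H i 0)
  have hprec : ∀ i, H i 0 * precoder H i 1 = (κ i : ℂ) • (1 : Matrix (Fin M) (Fin M) ℂ) := hκ
  have hrec : ∀ m τ, received P c H (fun i => ![X i, Z i]) N m τ =
      ∑ i, ((Real.sqrt (c i * P) : ℝ) : ℂ) * padLast (H i 0 * precoder H i 0 * X i) m τ +
        ∑ i, ((Real.sqrt (c i * P) * κ i : ℝ) : ℂ) * padFirst (Z i) m τ + N m τ := by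
    intro m τ
    simp only [received, transmitted, Matrix.mul_smul, Matrix.mul_add, ← Matrix.mul_assoc, hprec,
      mul_padLast, Matrix.add_apply, Matrix.smul_apply, Matrix.sum_apply, Matrix.smul_mul,
      Matrix.one_mul, smul_eq_mul, Matrix.cons_val_zero, Matrix.cons_val_one, Finset.mul_sum,
      ← Finset.sum_add_distrib]
    congr 1
    refine Finset.sum_congr rfl fun i _ => ?_
    rw [Real.sqrt_mul (hc i).le]
    push_cast
    ring
  have hlin : ∀ r m (w : ℂ), f r m (∑ i, ((Real.sqrt (c i * P) * κ i : ℝ) : ℂ) *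
      Z i (π r m) (r, 1) + w) =
      -(∑ i, ((Real.sqrt (c i * P) * κ i : ℝ) : ℂ) * Z i m (r, 0)) + f r m w := by
    intro r m w
    let g : ℂ →ₗ[ℝ] ℂ := (hf r m).mk' _
    change g _ = _ + g w
    rw [map_add, map_sum, ← Finset.sum_neg_distrib]
    congr 1
    refine Finset.sum_congr rfl fun i _ => ?_
    -- The coefficient is real, so it passes through the real-linear `f r m`; column cancellation
    -- then applies codeword by codeword.
    rw [← Complex.real_smul, map_smul, Complex.real_smul, ← mul_neg]
    congr 1
    exact eq_neg_of_add_eq_zero_right (hZ i r m)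
  ext m ⟨r, s⟩
  have hdes : ∀ t, desiredSignal P c H X m t =
      ∑ i, ((Real.sqrt (c i * P) : ℝ) : ℂ) * (H i 0 * precoder H i 0 * X i) m t := by
    intro t
    simp [desiredSignal, Matrix.sum_apply]
  rw [Matrix.add_apply, hdes]
  fin_cases s
  · simp [process, hrec, padLast, padFirst]
  · have h2 : ∀ m', received P c H (fun i => ![X i, Z i]) N m' (r, 2) =
        ∑ i, ((Real.sqrt (c i * P) * κ i : ℝ) : ℂ) * Z i m' (r, 1) + N m' (r, 2) := by
      intro m'
      simp [hrec, padLast, padFirst]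
    have h1 : received P c H (fun i => ![X i, Z i]) N m (r, 1) =
        ∑ i, ((Real.sqrt (c i * P) : ℝ) : ℂ) * (H i 0 * precoder H i 0 * X i) m (r, 1) +
          ∑ i, ((Real.sqrt (c i * P) * κ i : ℝ) : ℂ) * Z i m (r, 0) + N m (r, 1) := by
      simp [hrec, padLast, padFirst]
    change received P c H (fun i => ![X i, Z i]) N m (r, 1) +
      f r m (received P c H (fun i => ![X i, Z i]) N (π r m) (r, 2)) =
      ∑ i, ((Real.sqrt (c i * P) : ℝ) : ℂ) * (H i 0 * precoder H i 0 * X i) m (r, 1) +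
        (N m (r, 1) + f r m (N (π r m) (r, 2)))
    rw [h1, h2, hlin]
    ring

/-! ### The pairwise error probability -/

theorem exists_right_inverse_of_rank_eq {n : Type*} [Fintype n] {D : Matrix (Fin M) n ℂ}
    (h : D.rank = M) : ∃ R : Matrix n (Fin M) ℂ, D * R = 1 := by
  rw [← Matrix.mulVec_surjective_iff_exists_right_inverse, ← Matrix.coe_mulVecLin,
    ← LinearMap.range_eq_top]
  refine Submodule.eq_top_of_finrank_eq ?_
  rw [Module.finrank_fin_fun]
  exact h

theorem measurable_halfLogRatio {Ω : Type*} [MeasurableSpace Ω] (σ : Fin q → Fin M → ℝ≥0)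
    {D n : Ω → CodeMatrix M q} (hD : ∀ m t, Measurable fun ω => D ω m t)
    (hn : ∀ m t, Measurable fun ω => n ω m t) :
    Measurable fun ω => halfLogRatio σ (D ω) (n ω) := by
  have h : ∀ m t, Measurable fun ω => (star (D ω m t) * n ω m t).re := fun m t =>
    Complex.measurable_re.comp
      ((Complex.continuous_conj.measurable.comp (hD m t)).mul (hn m t))
  unfold halfLogRatio
  fun_prop

/-- Markov's inequality at level `1`, then Fubini to integrate over the noise before the channels.
-/
theorem measure_one_le_sum_le_lintegral {ι ι' : Type*} [Fintype ι] [Fintype ι'] (ν : Measure ℂ)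
    [IsProbabilityMeasure ν] {Φ : (ι → ℂ) → (ι' → ℂ) → ℝ≥0∞}
    (hΦ : Measurable fun p : (ι → ℂ) × (ι' → ℂ) => Φ p.1 p.2) :
    Measure.pi (fun _ : ι ⊕ ι' => ν)
        {x | 1 ≤ Φ (fun k => x (Sum.inl k)) fun k => x (Sum.inr k)} ≤
      ∫⁻ h, ∫⁻ n, Φ h n ∂Measure.pi (fun _ => ν) ∂Measure.pi (fun _ => ν) := by
  have hmp := measurePreserving_sumPiEquivProdPi (fun _ : ι ⊕ ι' => ν)
  have hmarkov := mul_meas_ge_le_lintegral₀ (hΦ.comp hmp.measurable).aemeasurable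
    (μ := Measure.pi (fun _ : ι ⊕ ι' => ν)) 1
  rw [one_mul] at hmarkov
  refine hmarkov.trans (le_of_eq ?_)
  simp only [Function.comp_apply]
  rw [hmp.lintegral_comp hΦ, lintegral_prod _ hΦ.aemeasurable]

theorem ae_pi_inr_of_ae {ι ι' : Type*} [Fintype ι] [Fintype ι'] (ν : Measure ℂ)
    [IsProbabilityMeasure ν] {p : ℂ → Prop} (hp : ∀ᵐ z ∂ν, p z) :
    ∀ᵐ x ∂Measure.pi (fun _ : ι ⊕ ι' => ν), ∀ k, p (x (Sum.inr k)) :=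
  ae_all_iff.2 fun k =>
    (measurePreserving_eval (fun _ : ι ⊕ ι' => ν) (Sum.inr k)).quasiMeasurePreserving.ae hp

theorem measure_halfLogRatio_nonneg_le {f : Fin q → Fin M → ℂ → ℂ} {σ : Fin q → Fin M → ℝ≥0}
    (π : Fin q → Equiv.Perm (Fin M))
    (hf : ∀ r m, HasLaw (f r m) (complexGaussian (σ r m ^ 2)) (complexGaussian 1))
    (P : ℝ) (c : Fin 2 → ℝ) (D : Fin 2 → CodeMatrix M q) :
    Measure.pi (fun _ : ((Fin 2 × Fin 2) × (Fin M × Fin M)) ⊕ (Fin M × (Fin q × Fin 3)) =>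
        complexGaussian 1) {x | 0 ≤ halfLogRatio σ
          (desiredSignal P c (channelOf fun k => x (Sum.inl k)) D)
          (process f π (Matrix.of fun m t => x (Sum.inr (m, t))))} ≤
      ∫⁻ h, ENNReal.ofReal (Real.exp (-∑ m, ∑ t, ‖desiredSignal P c (channelOf h) D m t‖ ^ 2 /
        (4 * noiseVariance σ m t))) ∂Measure.pi (fun _ => complexGaussian 1) := by
  -- `HasLaw` gives only a.e. measurability. A measurable version of `f` changes the processed noise
  -- on a null set only.
  let f' : Fin q → Fin M → ℂ → ℂ := fun r m => (hf r m).aemeasurable.mk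
  have hf'm : ∀ r m, Measurable (f' r m) := fun r m => (hf r m).aemeasurable.measurable_mk
  have hf' : ∀ r m, f r m =ᵐ[complexGaussian 1] f' r m := fun r m => (hf r m).aemeasurable.ae_eq_mk
  have hf'map : ∀ r m, (complexGaussian 1).map (f' r m) = complexGaussian (σ r m ^ 2) :=
    fun r m => (Measure.map_congr (hf' r m)).symm.trans (hf r m).map_eq
  let Φ : ((Fin 2 × Fin 2) × (Fin M × Fin M) → ℂ) → (Fin M × (Fin q × Fin 3) → ℂ) → ℝ≥0∞ :=
    fun h n => ENNReal.ofReal (Real.exp (halfLogRatio σ (desiredSignal P c (channelOf h) D)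
      (process f' π (Matrix.of fun m t => n (m, t)))))
  have hΦ : Measurable fun p : ((Fin 2 × Fin 2) × (Fin M × Fin M) → ℂ) ×
      (Fin M × (Fin q × Fin 3) → ℂ) => Φ p.1 p.2 := by
    refine (Real.measurable_exp.comp (measurable_halfLogRatio σ ?_ ?_)).ennreal_ofReal
    · exact fun m t => (measurable_desiredSignal_channelOf P c D m t).comp measurable_fst
    · rintro m ⟨r, s⟩
      have := hf'm r m
      fin_cases s <;> simp [process] <;> fun_prop
  have hae := ae_all_iff.2 fun r => ae_all_iff.2 fun m => ae_pi_inr_of_ae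
    (ι := (Fin 2 × Fin 2) × (Fin M × Fin M)) (ι' := Fin M × (Fin q × Fin 3)) _ (hf' r m)
  refine (measure_mono_ae ?_).trans ((measure_one_le_sum_le_lintegral _ hΦ).trans
    (lintegral_mono fun h => (lintegral_exp_halfLogRatio f' σ π hf'm hf'map _).le))
  filter_upwards [hae] with x hx hx0
  have hproc : process f π (Matrix.of fun m t => x (Sum.inr (m, t))) =
      process f' π (Matrix.of fun m t => x (Sum.inr (m, t))) := by
    ext m ⟨r, s⟩
    fin_cases s <;> simp [process, hx]
  change 0 ≤ halfLogRatio σ _ (process f π _) at hx0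
  rw [hproc] at hx0
  exact ENNReal.one_le_ofReal.2 (Real.one_le_exp hx0)

theorem exists_pairwiseError_le {Ω : Type*} [MeasurableSpace Ω] (μ : Measure Ω)
    [IsProbabilityMeasure μ] {f : Fin q → Fin M → ℂ → ℂ} {σ : Fin q → Fin M → ℝ≥0}
    (π : Fin q → Equiv.Perm (Fin M))
    (hf : ∀ r m, HasLaw (f r m) (complexGaussian (σ r m ^ 2)) (complexGaussian 1))
    {c : Fin 2 → ℝ} (hc : ∀ i, 0 < c i)
    {H : Fin 2 → Fin 2 → Ω → Matrix (Fin M) (Fin M) ℂ} {N : Ω → TimeMatrix M q}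
    (hindep : iIndepFun (entries H N) μ)
    (hlaw : ∀ k, HasLaw (entries H N k) (complexGaussian 1) μ)
    {X X' : Fin 2 → CodeMatrix M q} (hne : X ≠ X')
    (hrank : ∀ i, X i ≠ X' i → (X' i - X i).rank = M) :
    ∃ C : ℝ, 0 < C ∧ ∀ P : ℝ, 0 < P → pairwiseError μ P c σ H (fun ω =>
      desiredSignal P c (fun i j => H i j ω) X + process f π (N ω)) X X' ≤ C * P ^ (-(M : ℤ)) := by
  obtain ⟨i, hi⟩ := Function.ne_iff.1 hne
  -- For `M = 0` there is only one code matrix, so distinct codewords force `M ≠ 0`.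
  have : NeZero M := ⟨by
    rintro rfl
    exact hi (Matrix.ext fun a => a.elim0)⟩
  obtain ⟨R, hR⟩ := exists_right_inverse_of_rank_eq (hrank i hi)
  obtain ⟨C, hC, hbound⟩ := exists_lintegral_exp_neg_desiredSignal_le c hc σ (X' - X) i hR
  refine ⟨C, hC, fun P hP => ?_⟩
  have haem : AEMeasurable (fun ω k => entries H N k ω) μ :=
    aemeasurable_pi_lambda _ fun k => (hlaw k).aemeasurable
  have hmap : μ.map (fun ω k => entries H N k ω) = Measure.pi fun _ => complexGaussian 1 := by
    rw [(iIndepFun_iff_map_fun_eq_pi_map fun k => (hlaw k).aemeasurable).1 hindep]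
    congr 1
    ext1 k
    exact (hlaw k).map_eq
  -- The error event is included in the preimage of a set of entries; `Measure.le_map_apply` then
  -- requires no measurability of that set.
  refine ENNReal.toReal_le_of_le_ofReal (by positivity) ((measure_mono fun ω hω => ?_).trans
    ((Measure.le_map_apply haem {x | 0 ≤ halfLogRatio σ
      (desiredSignal P c (channelOf fun k => x (Sum.inl k)) (X' - X))
      (process f π (Matrix.of fun m t => x (Sum.inr (m, t))))}).trans ?_))
  · exact halfLogRatio_nonneg_of_likelihood_le hω
  · rw [hmap]
    exact (measure_halfLogRatio_nonneg_le π hf P c (X' - X)).trans (hbound P hP)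

/-! ### Diversity gain -/

theorem le_diversityGain {Pe : ℝ → ℝ} {C : ℝ} (hC : 0 < C)
    (h : ∀ P : ℝ, 0 < P → Pe P ≤ C * P ^ (-(M : ℤ))) : ((M : ℝ) : EReal) ≤ diversityGain Pe := by
  have hlim : Tendsto (fun P : ℝ => (((M : ℝ) - Real.log C / Real.log P : ℝ) : EReal)) atTop
      (nhds ((M : ℝ) : EReal)) := by
    refine (continuous_coe_real_ereal.tendsto _).comp ?_
    simpa using tendsto_const_nhds.sub (Real.tendsto_log_atTop.const_div_atTop (Real.log C))
  rw [← hlim.liminf_eq, diversityGain]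
  refine liminf_le_liminf ?_
  filter_upwards [eventually_gt_atTop 1] with P hP
  have hP0 : 0 < P := one_pos.trans hP
  have hlog : 0 < Real.log P := Real.log_pos hP
  -- Monotonicity of the extended logarithm also covers `Pe P = 0`, where it is `⊥`.
  have hle : ENNReal.log (ENNReal.ofReal (Pe P)) ≤
      ((Real.log C - M * Real.log P : ℝ) : EReal) := by
    refine (ENNReal.log_monotone (ENNReal.ofReal_le_ofReal (h P hP0))).trans (le_of_eq ?_)
    rw [ENNReal.log_ofReal_of_pos (by positivity), Real.log_mul hC.ne' (by positivity),
      Real.log_zpow]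
    congr 1
    push_cast
    ring
  have heq : (M : ℝ) - Real.log C / Real.log P =
      -(Real.log C - M * Real.log P) / Real.log P := by
    field_simp
    ring
  rw [heq, EReal.coe_div, EReal.coe_neg]
  exact EReal.div_le_div_right_of_nonneg (by exact_mod_cast hlog.le) (EReal.neg_le_neg_iff.2 hle)

end XNetwork

theorem theorem1 {Ω : Type*} [MeasurableSpace Ω] (μ : Measure Ω) [IsProbabilityMeasure μ]
    (M q L : ℕ) (hT : M ≤ 2 * q)
    -- the linear dispersion code and the four constellations
    (A B : Fin L → CodeMatrix M q) (S : Fin 2 → Fin 2 → Finset ℂ)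
    -- the column cancellation property
    (f : Fin q → Fin M → ℂ → ℂ) (σ : Fin q → Fin M → ℝ≥0) (π : Fin q → Equiv.Perm (Fin M))
    (hf : ∀ r m, HasLaw (f r m) (complexGaussian (σ r m ^ 2)) (complexGaussian 1))
    (hcancel : ∀ i j, ∀ X ∈ codebook A B (S i j), ColumnCancellation f π X)
    -- the power normalization constants
    (c : Fin 2 → ℝ) (hc : ∀ i, 0 < c i)
    -- the channels and the noise: all entries are i.i.d. `CN(0, 1)`
    (H : Fin 2 → Fin 2 → Ω → Matrix (Fin M) (Fin M) ℂ) (N : Ω → TimeMatrix M q)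
    (hindep : iIndepFun (entries H N) μ)
    (hlaw : ∀ k, HasLaw (entries H N k) (complexGaussian 1) μ)
    -- differences of distinct codewords for the first receiver have full rank
    (hrank : ∀ i, ∀ X ∈ codebook A B (S i 0), ∀ X' ∈ codebook A B (S i 0),
      X ≠ X' → (X - X').rank = M)
    -- two distinct pairs of codewords for the first receiver
    (X X' : Fin 2 → CodeMatrix M q) (hX : ∀ i, X i ∈ codebook A B (S i 0))
    (hX' : ∀ i, X' i ∈ codebook A B (S i 0)) (hne : X ≠ X') :
    -- the interference-free observation after interference cancellation
    let Yfree : ℝ → Ω → CodeMatrix M q := fun P ω =>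
      desiredSignal P c (fun i j => H i j ω) X + process f π (N ω)
    -- the processed received signal, `Z i` being the interfering codeword of transmitter `i`
    let Yproc : (Fin 2 → CodeMatrix M q) → ℝ → Ω → CodeMatrix M q := fun Z P ω =>
      process f π (received P c (fun i j => H i j ω) (fun i => ![X i, Z i]) (N ω))
    (∃ C : ℝ, 0 < C ∧ ∀ P : ℝ, 0 < P →
      pairwiseError μ P c σ H (Yfree P) X X' ≤ C * P ^ (-(M : ℤ)) ∧
      ((∀ r m, IsLinearMap ℝ (f r m)) →
        ∀ Z : Fin 2 → CodeMatrix M q, (∀ i, Z i ∈ codebook A B (S i 1)) →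
          pairwiseError μ P c σ H (Yproc Z P) X X' ≤ C * P ^ (-(M : ℤ)))) ∧
    ((M : ℝ) : EReal) ≤ diversityGain (fun P => pairwiseError μ P c σ H (Yfree P) X X') ∧
    ((∀ r m, IsLinearMap ℝ (f r m)) →
      ∀ Z : Fin 2 → CodeMatrix M q, (∀ i, Z i ∈ codebook A B (S i 1)) →
        ((M : ℝ) : EReal) ≤
          diversityGain (fun P => pairwiseError μ P c σ H (Yproc Z P) X X')) := by
  intro Yfree Yproc
  obtain ⟨C, hC, hbound⟩ := exists_pairwiseError_le μ π hf hc hindep hlaw hne fun i hi =>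
    hrank i _ (hX' i) _ (hX i) (Ne.symm hi)
  have hY : (∀ r m, IsLinearMap ℝ (f r m)) → ∀ Z : Fin 2 → CodeMatrix M q,
      (∀ i, Z i ∈ codebook A B (S i 1)) → ∀ P, Yproc Z P = Yfree P := fun hl Z hZ P =>
    funext fun ω => process_received hl P hc _ X Z (fun i => hcancel i 1 _ (hZ i)) (N ω)
  refine ⟨⟨C, hC, fun P hP => ⟨hbound P hP, fun hl Z hZ => ?_⟩⟩, le_diversityGain hC hbound,
    fun hl Z hZ => ?_⟩
  · rw [hY hl Z hZ]
    exact hbound P hP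
  · simp_rw [hY hl Z hZ]
    exact le_diversityGain hC hbound
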